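/- **Theorem (measure of symbol blocks of the 2-dimensional spatiotemporal cat lattice).** Let $s>2$ be a number with $2s\in\mathbb Z$. The cat lattice is the equation $$(-\Box+2(s-2))\,x_z=m_z,\qquad z=(n,t)\in\mathbb Z^2,\quad x_z\in[0,1),\quad m_z\in\mathcal A=\{-3,-2,\dots,2s-1\},$$ where $\Box x_{n,t}=x_{n,t+1}+x_{n+1,t}-4x_{n,t}+x_{n,t-1}+x_{n-1,t}$. Let $a,b\in\mathbb Z$ with $a+b=2s$. In the Hamiltonian form the lattice is the chain, with phase space $V=(\mathbb T^2)^{\mathbb Z}\ni(x_n,p_n)_{n\in\mathbb Z}$, of coupled cat maps $$x_{n,t+1}=p_{n,t}-x_{n+1,t}+a\,x_{n,t}-x_{n-1,t},\qquad p_{n,t+1}=b\,p_{n,t}+(ab-1)\,x_{n,t}-b\,(x_{n+1,t}+x_{n-1,t})\pmod 1,$$ and the natural measure $\mu$ is the infinite product $\prod_{n\in\mathbb Z}dx_n\,dp_n$ on $V$. Each point of $V$, taken as the state at time $t=0$, generates by the (invertible) dynamics a lattice state $(x_z)_{z\in\mathbb Z^2}$, $x_z\in[0,1)$, with symbols $m_z=(-\Box+2(s-2))x_z\in\mathcal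 A$. Let $\mathcal R\subset\mathbb Z^2$ be an $\ell_1\times\ell_2$ rectangle of lattice sites ($\ell_1,\ell_2\ge1$), let $\partial\mathcal R$ be the set of the sites outside $\mathcal R$ which have a nearest neighbour in $\mathcal R$, and for $i\in\partial\mathcal R$ let $\bar z_i$ be the unique nearest neighbour of $i$ in $\mathcal R$. Let $(\mathsf g_{zz'})_{z,z'\in\mathcal R}$ be the Dirichlet Green's function: $(-\Box+2(s-2))\,\mathsf g_{\cdot z'}=\delta_{\cdot z'}$ on $\mathcal R$ and $\mathsf g_{\cdot z'}=0$ on $\partial\mathcal R$. For a block of symbols $\mathsf M_{\mathcal R}=(m_z)_{z\in\mathcal R}\in\mathcal A^{\mathcal R}$ let $\mu(\mathsf M_{\mathcal R})$ be the $\mu$-measure of the cylinder set of all phase points whose lattice state has the symbols $m_z$ at all $z\in\mathcal R$, put $\bar x_z=\sum_{z'\in\mathcal R}\mathsf g_{zz'}m_{z'}$, and let $\mathcal P(\mathsf M_{\mathcal R})\subset\mathbb R^{\partial\mathcal R}$ be the $|\partial\mathcal R|$-dimensional polytope of all $(x_i)_{i\in\partial\mathcal R}$ with $$0\le x_i<1\quad(i\in\partial\mathcal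 R),\qquad 0\le\bar x_z+\sum_{i\in\partial\mathcal R}\mathsf g_{z\bar z_i}\,x_i<1\quad(z\in\mathcal R).$$ Then $$\mu(\mathsf M_{\mathcal R})=d(\mathcal R)\,|\mathcal P(\mathsf M_{\mathcal R})|,$$ where $|\mathcal P(\mathsf M_{\mathcal R})|$ is the volume of the polytope and the factor $d(\mathcal R)$ depends, for the given $s$, only on the sizes $\ell_1,\ell_2$ of $\mathcal R$; in particular it does not depend on the symbols $\mathsf M_{\mathcal R}$. -/

import Mathlib

open MeasureTheory

noncomputable section

namespace CatLattice

/-! ### The lattice operator -/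

/-- The Laplacian `□` of the square lattice; a site is `z = (n, t)` (space, time). -/
def laplacian (x : ℤ × ℤ → ℝ) (z : ℤ × ℤ) : ℝ :=
  x (z.1, z.2 + 1) + x (z.1 + 1, z.2) - 4 * x z + x (z.1, z.2 - 1) + x (z.1 - 1, z.2)

/-- The operator `-□ + 2(s - 2)` of the spatiotemporal cat lattice. -/
def catOp (s : ℝ) (x : ℤ × ℤ → ℝ) (z : ℤ × ℤ) : ℝ :=
  -laplacian x z + 2 * (s - 2) * x z

/-- The alphabet `{-3, -2, …, 2s - 2, 2s - 1}`. -/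
def alphabet (s : ℝ) : Set ℤ := {m | -3 ≤ m ∧ (m : ℝ) ≤ 2 * s - 1}

/-! ### Hamiltonian dynamics, natural measure, cylinder sets -/

/-- A phase point: coordinate and momentum `(x_n, p_n)`, both modulo `1`, of every particle. -/
abbrev Phase : Type := ℤ → UnitAddCircle × UnitAddCircle

/-- One time step of the chain of coupled cat maps (the integer winding numbers are
absorbed in the arithmetic modulo `1`), as a bijection of the phase space. -/
def evolution (a b : ℤ) : Equiv.Perm Phase where
  toFun Z n :=
    ((Z n).2 - (Z (n + 1)).1 + a • (Z n).1 - (Z (n - 1)).1,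
      b • (Z n).2 + (a * b - 1) • (Z n).1 - b • ((Z (n + 1)).1 + (Z (n - 1)).1))
  invFun Z n :=
    (b • (Z n).1 - (Z n).2,
      (Z n).1 + (b • (Z (n + 1)).1 - (Z (n + 1)).2) + (b • (Z (n - 1)).1 - (Z (n - 1)).2)
        - a • (b • (Z n).1 - (Z n).2))
  left_inv Z := by
    funext n
    refine Prod.ext ?_ ?_ <;> simp only [sub_add_cancel, add_sub_cancel_right] <;> module
  right_inv Z := by
    funext n
    refine Prod.ext ?_ ?_
    · simp only
      module
    · simp only [sub_add_cancel, add_sub_cancel_right]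
      module

/-- The natural measure: the product over all particles of `dx_n dp_n`. -/
def naturalMeasure : Measure Phase :=
  Measure.infinitePi fun _ : ℤ => (volume : Measure (UnitAddCircle × UnitAddCircle))

instance : IsProbabilityMeasure naturalMeasure := by
  have : IsProbabilityMeasure (volume : Measure UnitAddCircle) := ⟨by simp⟩
  unfold naturalMeasure
  infer_instance

/-- The lattice state `x_{n,t} ∈ [0,1)` generated by the phase point `Z` at time `0`. -/
def latticeState (a b : ℤ) (Z : Phase) (z : ℤ × ℤ) : ℝ :=
  AddCircle.equivIco (1 : ℝ) 0 ((evolution a b ^ z.2) Z z.1).1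

/-- The cylinder set of a block `M` of symbols on `R`: all phase points whose lattice state has
the symbol `(-□ + 2(s - 2)) x_z = M_z` at every `z ∈ R`; here `a + b = 2s`. -/
def cylinder (s : ℝ) (a b : ℤ) (R : Finset (ℤ × ℤ)) (M : R → ℤ) : Set Phase :=
  {Z | ∀ z : R, catOp s (latticeState a b Z) z = M z}

/-! ### Rectangles and their boundaries -/

/-- The `ℓ₁ × ℓ₂` rectangle whose lower left site is `c`. -/
def rectangle (c : ℤ × ℤ) (ℓ₁ ℓ₂ : ℕ) : Finset (ℤ × ℤ) :=
  Finset.Ico c.1 (c.1 + ℓ₁) ×ˢ Finset.Ico c.2 (c.2 + ℓ₂)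

/-- The four nearest neighbours of a site. -/
def neighbors (z : ℤ × ℤ) : Finset (ℤ × ℤ) :=
  {(z.1 + 1, z.2), (z.1 - 1, z.2), (z.1, z.2 + 1), (z.1, z.2 - 1)}

/-- The exterior boundary `∂R`: the sites outside `R` with a nearest neighbour in `R`. -/
def boundary (R : Finset (ℤ × ℤ)) : Finset (ℤ × ℤ) := R.biUnion neighbors \ R

theorem exists_inner {R : Finset (ℤ × ℤ)} (i : boundary R) :
    ∃ w : R, (i : ℤ × ℤ) ∈ neighbors w := by
  obtain ⟨w, hw, h⟩ := Finset.mem_biUnion.1 (Finset.mem_sdiff.1 i.2).1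
  exact ⟨⟨w, hw⟩, h⟩

/-- The site of `R` adjacent to the boundary site `i` (it is unique when `R` is a rectangle). -/
def inner {R : Finset (ℤ × ℤ)} (i : boundary R) : R := (exists_inner i).choose

/-! ### Dirichlet Green's function and the polytope -/

/-- The matrix of `-□ + 2(s - 2)` on functions on `R` that are extended by zero. -/
def dirichletMatrix (s : ℝ) (R : Finset (ℤ × ℤ)) : Matrix R R ℝ :=
  fun z w => catOp s (Pi.single (w : ℤ × ℤ) 1) z

/-- The Green's function `g_{z z'}` of `-□ + 2(s - 2)` on `R` which vanishes on `∂R`. -/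
def green (s : ℝ) (R : Finset (ℤ × ℤ)) : Matrix R R ℝ := (dirichletMatrix s R)⁻¹

theorem det_dirichletMatrix_ne_zero (s : ℝ) (hs : 2 < s) (R : Finset (ℤ × ℤ)) : (dirichletMatrix s R).det ≠ 0 := by
  apply det_ne_zero_of_sum_row_lt_diag
  intro k
  have hd : dirichletMatrix s R k k = 2 * s := by
    obtain ⟨⟨n,t⟩,hk⟩ := k
    simp [dirichletMatrix, catOp, laplacian]
    ring
  have hP : ∀ p : ℤ × ℤ, ∑ j : R, (if p = (j : ℤ × ℤ) then (1:ℝ) else 0) ≤ 1 := by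
    intro p
    rw [Finset.sum_coe_sort R (fun j => if p = j then (1:ℝ) else 0), Finset.sum_ite_eq]
    split_ifs <;> norm_num
  have hle : ∀ j ∈ Finset.univ.erase k, ‖dirichletMatrix s R k j‖ ≤
      (if ((k : ℤ × ℤ).1, (k : ℤ × ℤ).2+1) = (j : ℤ × ℤ) then (1:ℝ) else 0)
      + (if ((k : ℤ × ℤ).1+1, (k : ℤ × ℤ).2) = (j : ℤ × ℤ) then (1:ℝ) else 0)
      + (if ((k : ℤ × ℤ).1, (k : ℤ × ℤ).2-1) = (j : ℤ × ℤ) then (1:ℝ) else 0) + (if ((k : ℤ × ℤ).1-1, (k : ℤ × ℤ).2) = (j : ℤ × ℤ) then (1:ℝ) else 0) := by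
    intro j hj
    have : (k : ℤ × ℤ) ≠ j := fun e => (Finset.ne_of_mem_erase hj) (Subtype.ext e.symm)
    simp only [dirichletMatrix, catOp, laplacian, Pi.single_apply, if_neg this]
    rw [Real.norm_eq_abs, abs_le]
    constructor <;> split_ifs <;> norm_num
  refine (Finset.sum_le_sum hle).trans_lt ?_
  refine (Finset.sum_le_sum_of_subset_of_nonneg (Finset.subset_univ _)
    (fun _ _ _ => by positivity)).trans_lt ?_
  simp only [Finset.sum_add_distrib]
  rw [hd, Real.norm_eq_abs, abs_of_pos (by linarith)]
  linarith [hP ((k : ℤ × ℤ).1, (k : ℤ × ℤ).2+1), hP ((k : ℤ × ℤ).1+1, (k : ℤ × ℤ).2),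
    hP ((k : ℤ × ℤ).1, (k : ℤ × ℤ).2-1), hP ((k : ℤ × ℤ).1-1, (k : ℤ × ℤ).2)]

/-- For `s > 2` the matrix inverse in the definition of `green` is a genuine inverse. -/
theorem dirichletMatrix_mul_green (s : ℝ) (hs : 2 < s) (R : Finset (ℤ × ℤ)) :
    dirichletMatrix s R * green s R = 1 :=
  Matrix.mul_nonsing_inv _ (isUnit_iff_ne_zero.2 (det_dirichletMatrix_ne_zero s hs R))

/-- The averaged state `x̄_z = ∑_{z' ∈ R} g_{z z'} M_{z'}`. -/
def average (s : ℝ) (R : Finset (ℤ × ℤ)) (M : R → ℤ) (z : R) : ℝ :=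
  ∑ w : R, green s R z w * M w

/-- The polytope of boundary values that is attached to the block `M`. -/
def polytope (s : ℝ) (R : Finset (ℤ × ℤ)) (M : R → ℤ) : Set (boundary R → ℝ) :=
  {ξ | (∀ i, 0 ≤ ξ i ∧ ξ i < 1) ∧
    ∀ z : R, 0 ≤ average s R M z + ∑ i : boundary R, green s R z (inner i) * ξ i ∧
      average s R M z + ∑ i : boundary R, green s R z (inner i) * ξ i < 1}

end CatLattice

end

noncomputable section

namespace CatLattice

/-! ### Solutions of the lattice equation in an abelian group -/

/-! Modulo 1 the integer symbols vanish, so the lattice state becomes a solution on ℤ² of a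
homogeneous nearest-neighbour equation over the circle. Conversely, every such solution comes from a
phase point (`exists_circleState_eq`). The equation can be solved for the next row or the next
column, hence values on `freeSites` (the boundary with its top row replaced by the bottom row of the
rectangle) may be prescribed arbitrarily and extend to all of ℤ², and they determine a solution on
the closed rectangle (`exists_solution_freeSites`, `eq_of_eq_on_freeSites`).

The first fact makes the law of the state at the free sites invariant under every translation of the
torus, so it is Lebesgue measure (`map_circleState`). The second fact shows that the cylinder set is
exactly the event that the free values lie in `freeValues` (`cylinder_eq_preimage`). Its measure is
therefore the volume of that set.

Over ℝ a homogeneous solution on the rectangle is determined by its free values and, since the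
Dirichlet matrix is invertible, equally by its boundary values. This yields a linear isomorphism `L`
that does not involve the symbols. The symbols enter only through an affine shift, so `freeValues`
and the polytope have proportional volumes, the factor being the Jacobian of `L`. -/

/-- The nearest neighbour equation with on-site term `K`, at the site `z`. -/
def SolvesAt {G : Type*} [AddCommGroup G] (K : ℤ × ℤ → G → G) (x : ℤ × ℤ → G) (z : ℤ × ℤ) : Prop :=
  x (z.1, z.2 + 1) + x (z.1, z.2 - 1) + x (z.1 + 1, z.2) + x (z.1 - 1, z.2) = K z (x z)

theorem zpow_apply_of_step {α : Type*} (σ : Equiv.Perm α) (v : ℤ → α)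
    (h : ∀ t, σ (v t) = v (t + 1)) (t : ℤ) : (σ ^ t) (v 0) = v t := by
  induction t using Int.induction_on with
  | zero => simp
  | succ k ih => rw [add_comm, zpow_add, Equiv.Perm.mul_apply, ih, zpow_one, h, add_comm]
  | pred k ih =>
    rw [sub_eq_add_neg, add_comm, zpow_add, Equiv.Perm.mul_apply, ih, zpow_neg_one,
      Equiv.Perm.inv_eq_iff_eq, h]
    congr 1
    ring

/-- Carrying the time along with two consecutive values turns a time-dependent second-order
recursion into iteration of one permutation, whose integer powers run in both directions. -/
theorem exists_two_sided_recursion {A : Type*} [AddCommGroup A] (f : ℤ → A → A) (α β : A) :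
    ∃ u : ℤ → A, u 0 = α ∧ u (-1) = β ∧ ∀ t, u (t + 1) + u (t - 1) = f t (u t) := by
  let σ : Equiv.Perm (ℤ × A × A) :=
    { toFun := fun p => (p.1 + 1, f p.1 p.2.1 - p.2.2, p.2.1)
      invFun := fun p => (p.1 - 1, p.2.2, f (p.1 - 1) p.2.2 - p.2.1)
      left_inv := fun p => by simp
      right_inv := fun p => by simp }
  let v : ℤ → ℤ × A × A := fun t => (σ ^ t) (0, α, β)
  have hv : ∀ t, v (t + 1) = σ (v t) := fun t => by
    simp only [v]
    rw [add_comm, zpow_add, Equiv.Perm.mul_apply, zpow_one]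
  have h1 : ∀ t, (v (t + 1)).1 = (v t).1 + 1 := fun t => by rw [hv]; rfl
  have h2 : ∀ t, (v (t + 1)).2.1 = f (v t).1 (v t).2.1 - (v t).2.2 := fun t => by rw [hv]; rfl
  have h3 : ∀ t, (v (t + 1)).2.2 = (v t).2.1 := fun t => by rw [hv]; rfl
  have h3' : ∀ t, (v t).2.2 = (v (t - 1)).2.1 := fun t => by rw [← h3, sub_add_cancel]
  have h0 : v 0 = (0, α, β) := rfl
  have hfst : ∀ t, (v t).1 = t := fun t => by
    induction t using Int.induction_on with
    | zero => rw [h0]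
    | succ k ih => rw [h1, ih]
    | pred k ih =>
      have := h1 (-k - 1)
      rw [sub_add_cancel, ih] at this
      linarith
  refine ⟨fun t => (v t).2.1, rfl, ?_, fun t => ?_⟩
  · have := h3' 0
    rw [h0] at this
    simpa using this.symm
  · simp only
    rw [h2, hfst, h3', sub_add_cancel]

/-- Evolve in time the columns of the strip only, with the columns outside frozen to `Y`. The
equation is then guaranteed in the strip alone. -/
theorem exists_solution_strip {G : Type*} [AddCommGroup G] (K : ℤ × ℤ → G → G) (Y : ℤ × ℤ → G)
    (ℓ : ℤ) :
    ∃ x : ℤ × ℤ → G, (∀ n t, 0 ≤ n → n < ℓ → SolvesAt K x (n, t)) ∧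
      (∀ n t, ¬(0 ≤ n ∧ n < ℓ) → x (n, t) = Y (n, t)) ∧
      ∀ n, x (n, 0) = Y (n, 0) ∧ x (n, -1) = Y (n, -1) := by
  classical
  let e : (ℤ → G) → ℤ → ℤ → G := fun u t m => if 0 ≤ m ∧ m < ℓ then u m else Y (m, t)
  obtain ⟨u, h0, h1, h⟩ := exists_two_sided_recursion
    (fun t u n => K (n, t) (u n) - e u t (n + 1) - e u t (n - 1))
    (fun n => Y (n, 0)) (fun n => Y (n, -1))
  refine ⟨fun z => e (u z.2) z.2 z.1, fun n t hn hn' => ?_, fun n t hn => if_neg hn, fun n => ?_⟩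
  · have := congrFun (h t) n
    simp only [Pi.add_apply] at this
    have hi : ∀ t, e (u t) t n = u t n := fun t => if_pos ⟨hn, hn'⟩
    simp only [SolvesAt]
    rw [hi, hi, hi, this]
    abel
  · simp only [e, h0, h1, ite_self, and_self]

/-- The strip solution carries the prescribed data but may fail the equation outside the strip. Its
columns -1 and 0 are therefore used as initial data for a recursion in space, which gives a solution
everywhere. -/
theorem exists_solution {G : Type*} [AddCommGroup G] (K : ℤ × ℤ → G → G) (Y : ℤ × ℤ → G)
    {ℓ : ℤ} (hℓ : 1 ≤ ℓ) :
    ∃ x : ℤ × ℤ → G, (∀ z, SolvesAt K x z) ∧ (∀ t, x (-1, t) = Y (-1, t) ∧ x (ℓ, t) = Y (ℓ, t)) ∧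
      ∀ n, -1 ≤ n → n ≤ ℓ → x (n, 0) = Y (n, 0) ∧ x (n, -1) = Y (n, -1) := by
  obtain ⟨w, hw, hout, hrow⟩ := exists_solution_strip K Y ℓ
  obtain ⟨u, h0, h1, h⟩ := exists_two_sided_recursion
    (fun n (u : ℤ → G) t => K (n, t) (u t) - u (t + 1) - u (t - 1))
    (fun t => w (0, t)) (fun t => w (-1, t))
  have hs : ∀ z, SolvesAt K (fun z => u z.1 z.2) z := fun ⟨n, t⟩ => by
    have := congrFun (h n) t
    simp only [Pi.add_apply] at this
    simp only [SolvesAt]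
    rw [add_assoc, this]
    abel
  -- Column `k + 1` comes from the equation at column `k`, which `w` satisfies for `k < ℓ`; the
  -- agreement thus reaches column `ℓ`, just outside the strip.
  have key : ∀ k : ℕ, (k : ℤ) ≤ ℓ →
      (∀ t, u (k - 1) t = w (k - 1, t)) ∧ ∀ t, u k t = w (k, t) := fun k => by
    induction k with
    | zero => exact fun _ => ⟨by simp [h1], by simp [h0]⟩
    | succ k ih =>
      intro hk
      push_cast at hk ⊢
      obtain ⟨i1, i2⟩ := ih (by linarith)
      refine ⟨by simpa using i2, fun t => ?_⟩
      have e1 := hs (k, t)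
      have e2 := hw k t (by positivity) (by linarith)
      simp only [SolvesAt] at e1 e2
      rw [i2, i2, i2, i1, ← e2] at e1
      simpa using e1
  have key' : ∀ n t, -1 ≤ n → n ≤ ℓ → u n t = w (n, t) := fun n t hn hn' => by
    rcases hn.eq_or_lt with rfl | hn
    · exact congrFun h1 t
    · lift n to ℕ using by omega
      exact (key n hn').2 t
  refine ⟨fun z => u z.1 z.2, hs, fun t => ?_, fun n hn hn' => ?_⟩
  · simp only
    rw [key' _ _ le_rfl (by linarith), key' _ _ (by linarith) le_rfl]
    exact ⟨hout _ _ (by omega), hout _ _ (by omega)⟩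
  · simp only
    rw [key' _ _ hn hn', key' _ _ hn hn']
    exact hrow n

/-- Two consecutive rows together with the side values force the next row; the equation in row `ℓ₂ -
1` gives the top boundary row. -/
theorem solution_eq {G : Type*} [AddCommGroup G] {K : ℤ × ℤ → G → G} {x y : ℤ × ℤ → G}
    {ℓ₁ ℓ₂ : ℕ}
    (hx : ∀ n t : ℤ, 0 ≤ n → n < ℓ₁ → 0 ≤ t → t < ℓ₂ → SolvesAt K x (n, t))
    (hy : ∀ n t : ℤ, 0 ≤ n → n < ℓ₁ → 0 ≤ t → t < ℓ₂ → SolvesAt K y (n, t))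
    (hside : ∀ t : ℤ, 0 ≤ t → t < ℓ₂ → x (-1, t) = y (-1, t) ∧ x (ℓ₁, t) = y (ℓ₁, t))
    (hrow : ∀ n : ℤ, 0 ≤ n → n < ℓ₁ → x (n, 0) = y (n, 0) ∧ x (n, -1) = y (n, -1))
    {n t : ℤ} (hn : 0 ≤ n) (hn' : n < ℓ₁) (ht : -1 ≤ t) (ht' : t ≤ ℓ₂) : x (n, t) = y (n, t) := by
  have key : ∀ k : ℕ, (k : ℤ) ≤ ℓ₂ → (∀ n : ℤ, 0 ≤ n → n < ℓ₁ → x (n, k - 1) = y (n, k - 1)) ∧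
      ∀ n : ℤ, 0 ≤ n → n < ℓ₁ → x (n, k) = y (n, k) := fun k => by
    induction k with
    | zero =>
      exact fun _ => ⟨fun n h h' => by simpa using (hrow n h h').2,
        fun n h h' => by simpa using (hrow n h h').1⟩
    | succ k ih =>
      intro hk
      push_cast at hk ⊢
      obtain ⟨i1, i2⟩ := ih (by linarith)
      refine ⟨by simpa using i2, fun n h h' => ?_⟩
      have hs : ∀ m : ℤ, -1 ≤ m → m ≤ ℓ₁ → x (m, k) = y (m, k) := fun m hm hm' => by
        rcases hm.eq_or_lt with rfl | hm
        · exact (hside k (by positivity) (by linarith)).1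
        rcases hm'.eq_or_lt with rfl | hm'
        · exact (hside k (by positivity) (by linarith)).2
        · exact i2 m (by omega) hm'
      have e1 := hx n k h h' (by positivity) (by linarith)
      have e2 := hy n k h h' (by positivity) (by linarith)
      simp only [SolvesAt] at e1 e2
      rw [i2 n h h', ← e2, i1 n h h', hs (n + 1) (by omega) (by omega),
        hs (n - 1) (by omega) (by omega)] at e1
      simpa using e1
  rcases ht.eq_or_lt with rfl | ht
  · exact (hrow n hn hn').2
  · lift t to ℕ using by omega
    exact (key t ht').2 n hn hn'

/-! ### The lattice state modulo one -/

/-- The lattice state generated by `Z`, modulo `1`. -/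
def circleState (a b : ℤ) (Z : Phase) (z : ℤ × ℤ) : UnitAddCircle :=
  ((evolution a b ^ z.2) Z z.1).1

theorem coe_latticeState (a b : ℤ) (Z : Phase) (z : ℤ × ℤ) :
    (latticeState a b Z z : UnitAddCircle) = circleState a b Z z :=
  AddCircle.coe_equivIco

theorem latticeState_mem (a b : ℤ) (Z : Phase) (z : ℤ × ℤ) :
    0 ≤ latticeState a b Z z ∧ latticeState a b Z z < 1 := by
  have := (AddCircle.equivIco (1 : ℝ) 0 (circleState a b Z z)).2
  exact ⟨this.1, this.2.trans_eq (zero_add 1)⟩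

/-- The inverse map gives `x_{n,t-1} = b x_{n,t} - p_{n,t}`; adding `x_{n,t+1}` eliminates the
momentum and leaves only `a + b`. -/
theorem solvesAt_circleState (a b : ℤ) (Z : Phase) (z : ℤ × ℤ) :
    SolvesAt (fun _ u => (a + b) • u) (circleState a b Z) z := by
  obtain ⟨n, t⟩ := z
  have h1 : (evolution a b ^ (t + 1)) Z = evolution a b ((evolution a b ^ t) Z) := by
    rw [add_comm, zpow_add, Equiv.Perm.mul_apply, zpow_one]
  have h2 : (evolution a b ^ (t - 1)) Z = (evolution a b).symm ((evolution a b ^ t) Z) := by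
    rw [sub_eq_add_neg, add_comm, zpow_add, Equiv.Perm.mul_apply, zpow_neg_one]
    rfl
  simp only [SolvesAt, circleState]
  rw [h1, h2]
  generalize (evolution a b ^ t) Z = W
  change ((W n).2 - (W (n + 1)).1 + a • (W n).1 - (W (n - 1)).1) + (b • (W n).1 - (W n).2)
    + (W (n + 1)).1 + (W (n - 1)).1 = (a + b) • (W n).1
  module

theorem exists_circleState_eq (a b : ℤ) {τ : ℤ × ℤ → UnitAddCircle}
    (hτ : ∀ z, SolvesAt (fun _ u => (a + b) • u) τ z) : ∃ Z, circleState a b Z = τ := by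
  -- The momentum is recovered from two consecutive times: `p_t = b x_t - x_{t-1}`.
  let v : ℤ → Phase := fun t n => (τ (n, t), b • τ (n, t) - τ (n, t - 1))
  refine ⟨v 0, funext fun ⟨n, t⟩ => ?_⟩
  have h : ∀ t, evolution a b (v t) = v (t + 1) := fun t => by
    funext n
    have e : τ (n, t + 1) = (a + b) • τ (n, t) - τ (n, t - 1) - τ (n + 1, t) - τ (n - 1, t) := by
      have : _ = (a + b) • τ (n, t) := hτ (n, t)
      rw [← this]
      abel
    refine Prod.ext ?_ ?_ <;> simp only [v, evolution, Equiv.coe_fn_mk, add_sub_cancel_right, e] <;>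
      module
  exact congrArg Prod.fst (congrFun (zpow_apply_of_step _ v h t) n)

theorem catOp_eq_iff {s : ℝ} {x : ℤ × ℤ → ℝ} {m : ℝ} {z : ℤ × ℤ} :
    catOp s x z = m ↔
      x (z.1, z.2 + 1) + x (z.1, z.2 - 1) + x (z.1 + 1, z.2) + x (z.1 - 1, z.2)
        = 2 * s * x z - m := by
  simp only [catOp, laplacian]
  constructor <;> intro h <;> linarith

/-! ### The free sites -/

/-- Sites of the closed rectangle at which a solution on the rectangle at the origin may be
prescribed at will, and which determine it: the two bottom rows and the two sides. -/
def freeSites (ℓ₁ ℓ₂ : ℕ) : Finset (ℤ × ℤ) :=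
  Finset.Ico 0 (ℓ₁ : ℤ) ×ˢ {0, -1} ∪ {-1, (ℓ₁ : ℤ)} ×ˢ Finset.Ico 0 (ℓ₂ : ℤ)

theorem mem_freeSites {ℓ₁ ℓ₂ : ℕ} {n t : ℤ} : (n, t) ∈ freeSites ℓ₁ ℓ₂ ↔
    ((0 ≤ n ∧ n < ℓ₁) ∧ (t = 0 ∨ t = -1)) ∨ ((n = -1 ∨ n = ℓ₁) ∧ (0 ≤ t ∧ t < ℓ₂)) := by
  simp [freeSites]

/-- The generality in `G` and `K` serves two uses: the homogeneous equation over the circle, and the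
equation over ℝ whose on-site term contains the symbol of the site. -/
theorem exists_solution_freeSites {G : Type*} [AddCommGroup G] (K : ℤ × ℤ → G → G) {ℓ₁ ℓ₂ : ℕ}
    (h : 1 ≤ ℓ₁) (y : freeSites ℓ₁ ℓ₂ → G) :
    ∃ x : ℤ × ℤ → G, (∀ z, SolvesAt K x z) ∧ ∀ f : freeSites ℓ₁ ℓ₂, x f = y f := by
  classical
  let Y : ℤ × ℤ → G := fun z => if hz : z ∈ freeSites ℓ₁ ℓ₂ then y ⟨z, hz⟩ else 0
  obtain ⟨x, hx, h1, h2⟩ := exists_solution K Y (ℓ := ℓ₁) (by exact_mod_cast h)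
  refine ⟨x, hx, fun ⟨⟨n, t⟩, hf⟩ => ?_⟩
  have hY : x (n, t) = Y (n, t) := by
    rcases mem_freeSites.1 hf with ⟨⟨hn, hn'⟩, rfl | rfl⟩ | ⟨rfl | rfl, -⟩
    · exact (h2 n (by omega) hn'.le).1
    · exact (h2 n (by omega) hn'.le).2
    · exact (h1 t).1
    · exact (h1 t).2
  rw [hY]
  exact dif_pos hf

theorem mem_rectangle {c : ℤ × ℤ} {ℓ₁ ℓ₂ : ℕ} {n t : ℤ} : (n, t) ∈ rectangle c ℓ₁ ℓ₂ ↔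
    (c.1 ≤ n ∧ n < c.1 + ℓ₁) ∧ (c.2 ≤ t ∧ t < c.2 + ℓ₂) := by
  simp [rectangle]

theorem mem_neighbors {w : ℤ × ℤ} {n t : ℤ} : (n, t) ∈ neighbors w ↔
    ((n = w.1 + 1 ∨ n = w.1 - 1) ∧ t = w.2) ∨ (n = w.1 ∧ (t = w.2 + 1 ∨ t = w.2 - 1)) := by
  simp only [neighbors, Finset.mem_insert, Finset.mem_singleton, Prod.mk.injEq]
  tauto

theorem mem_boundary_rectangle {c : ℤ × ℤ} {ℓ₁ ℓ₂ : ℕ} (h₁ : 1 ≤ ℓ₁) (h₂ : 1 ≤ ℓ₂) {n t : ℤ} :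
    (n, t) ∈ boundary (rectangle c ℓ₁ ℓ₂) ↔
      ((c.1 ≤ n ∧ n < c.1 + ℓ₁) ∧ (t = c.2 - 1 ∨ t = c.2 + ℓ₂)) ∨
      ((n = c.1 - 1 ∨ n = c.1 + ℓ₁) ∧ (c.2 ≤ t ∧ t < c.2 + ℓ₂)) := by
  simp only [boundary, Finset.mem_sdiff, Finset.mem_biUnion, Prod.exists, mem_rectangle,
    mem_neighbors]
  constructor
  · rintro ⟨⟨n', t', h, h'⟩, h''⟩
    omega
  · rintro (⟨h, rfl | rfl⟩ | ⟨rfl | rfl, h⟩)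
    · exact ⟨⟨n, c.2, by omega⟩, by omega⟩
    · exact ⟨⟨n, c.2 + ℓ₂ - 1, by omega⟩, by omega⟩
    · exact ⟨⟨c.1, t, by omega⟩, by omega⟩
    · exact ⟨⟨c.1 + ℓ₁ - 1, t, by omega⟩, by omega⟩

/-- A site with two distinct neighbours in a rectangle lies in it: it is either their midpoint or a
corner of the box they span. -/
theorem mem_neighbors_iff_inner {c : ℤ × ℤ} {ℓ₁ ℓ₂ : ℕ} (i : boundary (rectangle c ℓ₁ ℓ₂))
    (w : rectangle c ℓ₁ ℓ₂) : (i : ℤ × ℤ) ∈ neighbors w ↔ inner i = w := by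
  have key : ∀ w w' : rectangle c ℓ₁ ℓ₂, (i : ℤ × ℤ) ∈ neighbors w →
      (i : ℤ × ℤ) ∈ neighbors w' → w = w' := by
    obtain ⟨⟨n, t⟩, hi⟩ := i
    have hi' := (Finset.mem_sdiff.1 hi).2
    rintro ⟨⟨p, q⟩, h⟩ ⟨⟨p', q'⟩, h'⟩ e e'
    have g := mem_rectangle.1 h
    have g' := mem_rectangle.1 h'
    rw [mem_rectangle] at hi'
    rw [mem_neighbors] at e e'
    rw [Subtype.mk.injEq, Prod.mk.injEq]
    simp only at e e'
    omega
  exact ⟨fun h => key _ _ (exists_inner i).choose_spec h, fun h => h ▸ (exists_inner i).choose_spec⟩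

theorem freeSites_subset {ℓ₁ ℓ₂ : ℕ} (h₁ : 1 ≤ ℓ₁) (h₂ : 1 ≤ ℓ₂) :
    freeSites ℓ₁ ℓ₂ ⊆ rectangle 0 ℓ₁ ℓ₂ ∪ boundary (rectangle 0 ℓ₁ ℓ₂) := by
  rintro ⟨n, t⟩ h
  rw [mem_freeSites] at h
  rw [Finset.mem_union, mem_boundary_rectangle h₁ h₂, mem_rectangle]
  simp only [Prod.fst_zero, Prod.snd_zero]
  omega

theorem eq_of_eq_on_freeSites {G : Type*} [AddCommGroup G] {K : ℤ × ℤ → G → G}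
    {x y : ℤ × ℤ → G} {ℓ₁ ℓ₂ : ℕ} (h₁ : 1 ≤ ℓ₁) (h₂ : 1 ≤ ℓ₂)
    (hx : ∀ z ∈ rectangle 0 ℓ₁ ℓ₂, SolvesAt K x z)
    (hy : ∀ z ∈ rectangle 0 ℓ₁ ℓ₂, SolvesAt K y z) (h : ∀ z ∈ freeSites ℓ₁ ℓ₂, x z = y z) :
    ∀ z ∈ rectangle 0 ℓ₁ ℓ₂ ∪ boundary (rectangle 0 ℓ₁ ℓ₂), x z = y z := by
  have hR : ∀ n t : ℤ, 0 ≤ n → n < ℓ₁ → 0 ≤ t → t < ℓ₂ → (n, t) ∈ rectangle 0 ℓ₁ ℓ₂ :=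
    fun n t a b c d => mem_rectangle.2 (by simpa using ⟨⟨a, b⟩, c, d⟩)
  have key : ∀ n t : ℤ, 0 ≤ n → n < ℓ₁ → -1 ≤ t → t ≤ ℓ₂ → x (n, t) = y (n, t) :=
    fun n t a b c d => solution_eq (fun n t a b c d => hx _ (hR n t a b c d))
      (fun n t a b c d => hy _ (hR n t a b c d))
      (fun t a b => ⟨h _ (mem_freeSites.2 (by simp [a, b])), h _ (mem_freeSites.2 (by simp [a, b]))⟩)
      (fun n a b => ⟨h _ (mem_freeSites.2 (by simp [a, b])), h _ (mem_freeSites.2 (by simp [a, b]))⟩)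
      a b c d
  rintro ⟨n, t⟩ hz
  by_cases hf : (n, t) ∈ freeSites ℓ₁ ℓ₂
  · exact h _ hf
  rw [mem_freeSites] at hf
  rw [Finset.mem_union, mem_boundary_rectangle h₁ h₂, mem_rectangle] at hz
  simp only [Prod.fst_zero, Prod.snd_zero] at hz
  exact key n t (by omega) (by omega) (by omega) (by omega)

/-! ### The lattice state is uniformly distributed on the free sites -/

theorem measurable_evolution (a b : ℤ) : Measurable (evolution a b) := by
  refine measurable_pi_lambda _ fun n => Measurable.prodMk ?_ ?_ <;> fun_prop

theorem measurable_evolution_symm (a b : ℤ) : Measurable (evolution a b).symm := by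
  refine measurable_pi_lambda _ fun n => Measurable.prodMk ?_ ?_ <;> fun_prop

theorem measurable_evolution_zpow (a b t : ℤ) : Measurable ⇑(evolution a b ^ t) := by
  induction t using Int.induction_on with
  | zero => exact measurable_id
  | succ k ih =>
    rw [zpow_add, zpow_one]
    exact ih.comp (measurable_evolution a b)
  | pred k ih =>
    rw [sub_eq_add_neg, zpow_add, zpow_neg_one]
    exact ih.comp (measurable_evolution_symm a b)

theorem measurable_circleState (a b : ℤ) (z : ℤ × ℤ) :
    Measurable fun Z => circleState a b Z z :=
  ((measurable_pi_apply z.1).comp (measurable_evolution_zpow a b z.2)).fst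

theorem evolution_add (a b : ℤ) (Z W : Phase) :
    evolution a b (Z + W) = evolution a b Z + evolution a b W := by
  funext n
  refine Prod.ext ?_ ?_ <;>
    simp only [evolution, Equiv.coe_fn_mk, Pi.add_apply, Prod.fst_add, Prod.snd_add] <;> module

theorem evolution_zpow_add (a b t : ℤ) (Z W : Phase) :
    (evolution a b ^ t) (Z + W) = (evolution a b ^ t) Z + (evolution a b ^ t) W := by
  induction t using Int.induction_on generalizing Z W with
  | zero => rfl
  | succ k ih =>
    rw [zpow_add, zpow_one]
    simp only [Equiv.Perm.mul_apply, evolution_add, ih]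
  | pred k ih =>
    have h : ∀ Z W, (evolution a b)⁻¹ (Z + W) = (evolution a b)⁻¹ Z + (evolution a b)⁻¹ W :=
      fun Z W => by
        rw [Equiv.Perm.inv_eq_iff_eq, evolution_add]
        exact congrArg₂ (· + ·) ((evolution a b).apply_symm_apply Z).symm
          ((evolution a b).apply_symm_apply W).symm
    rw [sub_eq_add_neg, zpow_add, zpow_neg_one]
    simp only [Equiv.Perm.mul_apply, h, ih]

theorem circleState_add (a b : ℤ) (Z W : Phase) (z : ℤ × ℤ) :
    circleState a b (Z + W) z = circleState a b Z z + circleState a b W z := by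
  simp only [circleState, evolution_zpow_add, Pi.add_apply, Prod.fst_add]

instance : IsProbabilityMeasure (volume : Measure UnitAddCircle) := ⟨by simp⟩

theorem map_add_naturalMeasure (W : Phase) :
    naturalMeasure.map (fun Z => W + Z) = naturalMeasure := by
  have h := Measure.infinitePi_map_pi (fun _ : ℤ => (volume : Measure (UnitAddCircle × UnitAddCircle)))
    (f := fun n u => W n + u) (fun n => measurable_const_add _)
  have : (volume : Measure (UnitAddCircle × UnitAddCircle)).IsAddLeftInvariant :=
    inferInstanceAs (Measure.prod volume volume).IsAddLeftInvariant
  unfold naturalMeasure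
  refine h.trans ?_
  congr 1
  funext n
  exact (measurePreserving_add_left volume (W n)).map_eq

/-- A translation invariant probability measure on a torus is Lebesgue measure. -/
theorem eq_volume_of_map_add {ι : Type*} [Fintype ι] (ν : Measure (ι → UnitAddCircle))
    [IsProbabilityMeasure ν] (h : ∀ w, ν.map (fun u => w + u) = ν) : ν = volume := by
  have : ν.IsAddLeftInvariant := ⟨h⟩
  have : ν.IsAddHaarMeasure := Measure.isAddHaarMeasure_of_isCompact_nonempty_interior ν Set.univ
    isCompact_univ (by simp) (by simp) (by simp)
  exact Measure.isAddHaarMeasure_eq_of_isProbabilityMeasure _ _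

/-- A shift by `w` of the free values is realised by adding to the phase point some `W` whose state
equals `w` there. The state is additive in the phase point and the natural measure is translation
invariant, so the law is invariant under all shifts. -/
theorem map_circleState {ℓ₁ : ℕ} (ℓ₂ : ℕ) (h : 1 ≤ ℓ₁) (a b : ℤ) (c : ℤ × ℤ) :
    naturalMeasure.map (fun Z (f : freeSites ℓ₁ ℓ₂) => circleState a b Z (f + c)) = volume := by
  have hm : Measurable fun Z (f : freeSites ℓ₁ ℓ₂) => circleState a b Z (f + c) :=
    measurable_pi_lambda _ fun f => measurable_circleState a b _
  have := Measure.isProbabilityMeasure_map (μ := naturalMeasure) hm.aemeasurable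
  refine eq_volume_of_map_add _ fun w => ?_
  obtain ⟨x, hx, hxw⟩ := exists_solution_freeSites (fun _ u => (a + b) • u) h w
  obtain ⟨W, hW⟩ := exists_circleState_eq a b (τ := fun z => x (z - c)) fun z => by
    have := hx (z - c)
    simp only [SolvesAt, Prod.fst_sub, Prod.snd_sub] at this ⊢
    rw [← this]
    congr 1
    · congr 1
      · congr 1 <;> congr 1 <;> ext <;> simp <;> ring
      · congr 1; ext <;> simp; ring
    · congr 1; ext <;> simp; ring
  rw [Measure.map_map (measurable_const_add w) hm]
  conv_rhs => rw [← map_add_naturalMeasure W, Measure.map_map hm (measurable_const_add W)]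
  congr 1
  funext Z f
  simp [circleState_add, hW, hxw]

theorem measurePreserving_equivIco :
    MeasurePreserving (fun u : UnitAddCircle => (AddCircle.equivIco (1 : ℝ) 0 u : ℝ)) volume
      (volume.restrict (Set.Ico 0 1)) := by
  have hm : Measurable fun u : UnitAddCircle => (AddCircle.equivIco (1 : ℝ) 0 u : ℝ) :=
    measurable_subtype_coe.comp (AddCircle.measurableEquivIco (1 : ℝ) 0).measurable
  refine ⟨hm, ?_⟩
  have h := (AddCircle.measurePreserving_mk (1 : ℝ) 0).map_eq
  rw [zero_add, ← Measure.restrict_congr_set Ico_ae_eq_Ioc] at h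
  rw [← h, Measure.map_map hm AddCircle.measurable_mk']
  conv_rhs => rw [← Measure.map_id (μ := volume.restrict (Set.Ico (0 : ℝ) 1))]
  refine Measure.map_congr ((ae_restrict_iff' measurableSet_Ico).2 (.of_forall fun u hu => ?_))
  exact congrArg Subtype.val (AddCircle.equivIco_coe_eq (p := (1 : ℝ)) (a := 0) (x := u)
    (by rwa [zero_add]))

theorem measurePreserving_latticeState {ℓ₁ : ℕ} (ℓ₂ : ℕ) (h : 1 ≤ ℓ₁) (a b : ℤ) (c : ℤ × ℤ) :
    MeasurePreserving (fun Z (f : freeSites ℓ₁ ℓ₂) => latticeState a b Z (f + c)) naturalMeasure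
      (volume.restrict (Set.univ.pi fun _ => Set.Ico 0 1)) := by
  have h1 : MeasurePreserving (fun Z (f : freeSites ℓ₁ ℓ₂) => circleState a b Z (f + c))
      naturalMeasure volume :=
    ⟨measurable_pi_lambda _ fun f => measurable_circleState a b _, map_circleState ℓ₂ h a b c⟩
  have h2 := measurePreserving_pi (ι := freeSites ℓ₁ ℓ₂) (fun _ => volume)
    (fun _ => volume.restrict (Set.Ico (0 : ℝ) 1)) (fun _ => measurePreserving_equivIco)
  rw [volume_pi, Measure.restrict_pi_pi]
  exact h2.comp h1

/-! ### The Dirichlet problem -/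

theorem catOp_add (s : ℝ) (x y : ℤ × ℤ → ℝ) (z : ℤ × ℤ) :
    catOp s (x + y) z = catOp s x z + catOp s y z := by
  simp only [catOp, laplacian, Pi.add_apply]
  ring

theorem catOp_smul (s r : ℝ) (x : ℤ × ℤ → ℝ) (z : ℤ × ℤ) :
    catOp s (r • x) z = r * catOp s x z := by
  simp only [catOp, laplacian, Pi.smul_apply, smul_eq_mul]
  ring

theorem catOp_sub (s : ℝ) (x y : ℤ × ℤ → ℝ) (z : ℤ × ℤ) :
    catOp s (x - y) z = catOp s x z - catOp s y z := by
  simp only [catOp, laplacian, Pi.sub_apply]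
  ring

theorem catOp_eq_sum_neighbors (s : ℝ) (x : ℤ × ℤ → ℝ) (z : ℤ × ℤ) :
    catOp s x z = 2 * s * x z - ∑ w ∈ neighbors z, x w := by
  rw [neighbors, Finset.sum_insert (by simp; omega), Finset.sum_insert (by simp),
    Finset.sum_insert (by simp; omega), Finset.sum_singleton, catOp, laplacian]
  ring

/-- Each neighbour of a site of `R` lies in `R` or in its boundary; the former produce the
off-diagonal matrix entries, the latter a source term. -/
theorem catOp_eq_dirichletMatrix (s : ℝ) (R : Finset (ℤ × ℤ)) (x : ℤ × ℤ → ℝ) (z : R) :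
    catOp s x z = ∑ w : R, dirichletMatrix s R z w * x w
      - ∑ i : boundary R, if (i : ℤ × ℤ) ∈ neighbors z then x i else 0 := by
  classical
  have hD : ∀ w : R, dirichletMatrix s R z w * x w =
      (if w = z then 2 * s * x w else 0) - if (w : ℤ × ℤ) ∈ neighbors z then x w else 0 := by
    intro w
    rw [dirichletMatrix, catOp_eq_sum_neighbors, Finset.sum_pi_single', Pi.single_apply]
    by_cases h : w = z
    · subst h
      simp [sub_mul]
    · have h' : (z : ℤ × ℤ) ≠ w := fun e => h (Subtype.ext e.symm)
      simp [h, h']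
  rw [catOp_eq_sum_neighbors, Finset.sum_congr rfl fun w _ => hD w, Finset.sum_sub_distrib,
    Finset.sum_ite_eq' Finset.univ z, if_pos (Finset.mem_univ z), sub_sub]
  congr 1
  rw [Finset.sum_coe_sort R fun w => if w ∈ neighbors z then x w else 0,
    Finset.sum_coe_sort (boundary R) fun w => if w ∈ neighbors z then x w else 0,
    ← Finset.sum_filter, ← Finset.sum_filter,
    ← Finset.sum_filter_add_sum_filter_not (neighbors z) (· ∈ R)]
  congr 1 <;> refine Finset.sum_congr (Finset.ext fun w => ?_) fun _ _ => rfl <;>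
    simp only [Finset.mem_filter, boundary, Finset.mem_sdiff, Finset.mem_biUnion]
  · tauto
  · exact ⟨fun h => ⟨⟨⟨z, z.2, h.1⟩, h.2⟩, h.1⟩, fun h => ⟨h.2, h.1.2⟩⟩

/-- The Dirichlet problem on `R` is solved by the Green's function. -/
theorem catOp_eq_iff_green_of_inner {s : ℝ} (hs : 2 < s) {R : Finset (ℤ × ℤ)}
    (hR : ∀ (i : boundary R) (w : R), (i : ℤ × ℤ) ∈ neighbors w ↔ inner i = w)
    (M : R → ℝ) (x : ℤ × ℤ → ℝ) :
    (∀ z : R, catOp s x z = M z) ↔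
      ∀ z : R, x z = ∑ w, green s R z w * M w +
        ∑ i : boundary R, green s R z (inner i) * x i := by
  classical
  let u : R → ℝ := fun z => x z
  -- `β` collects the boundary values adjacent to each site, so that the Dirichlet problem reads `D
  -- u = M + β`.
  let β : R → ℝ := fun z => ∑ i : boundary R, if inner i = z then x i else 0
  have hβ : ∀ z : R, ∑ w, green s R z w * β w =
      ∑ i : boundary R, green s R z (inner i) * x i := fun z => by
    simp only [β, Finset.mul_sum, mul_ite, mul_zero]
    rw [Finset.sum_comm]
    exact Finset.sum_congr rfl fun i _ => by simp
  have h1 : dirichletMatrix s R * green s R = 1 := dirichletMatrix_mul_green s hs R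
  have h2 : green s R * dirichletMatrix s R = 1 := mul_eq_one_comm.1 h1
  have hL : (∀ z : R, catOp s x z = M z) ↔ (dirichletMatrix s R).mulVec u = M + β := by
    rw [funext_iff]
    refine forall_congr' fun z => ?_
    rw [catOp_eq_dirichletMatrix s R x z, sub_eq_iff_eq_add]
    simp only [hR]
    rfl
  have hG : (∀ z : R, x z = ∑ w, green s R z w * M w +
        ∑ i : boundary R, green s R z (inner i) * x i) ↔ u = (green s R).mulVec (M + β) := by
    rw [funext_iff]
    refine forall_congr' fun z => ?_
    rw [← hβ, Matrix.mulVec_add]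
    rfl
  rw [hL, hG]
  constructor
  · intro h
    rw [← h, Matrix.mulVec_mulVec, h2, Matrix.one_mulVec]
  · intro h
    rw [h, Matrix.mulVec_mulVec, h1, Matrix.one_mulVec]

theorem catOp_eq_iff_green {s : ℝ} (hs : 2 < s) {c : ℤ × ℤ} {ℓ₁ ℓ₂ : ℕ}
    (M : rectangle c ℓ₁ ℓ₂ → ℝ) (x : ℤ × ℤ → ℝ) :
    (∀ z : rectangle c ℓ₁ ℓ₂, catOp s x z = M z) ↔
      ∀ z : rectangle c ℓ₁ ℓ₂, x z = ∑ w, green s (rectangle c ℓ₁ ℓ₂) z w * M w +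
        ∑ i : boundary (rectangle c ℓ₁ ℓ₂), green s (rectangle c ℓ₁ ℓ₂) z (inner i) * x i :=
  catOp_eq_iff_green_of_inner hs mem_neighbors_iff_inner M x

theorem exists_dirichlet {s : ℝ} (hs : 2 < s) {c : ℤ × ℤ} {ℓ₁ ℓ₂ : ℕ}
    (M : rectangle c ℓ₁ ℓ₂ → ℝ) (ξ : boundary (rectangle c ℓ₁ ℓ₂) → ℝ) :
    ∃ x : ℤ × ℤ → ℝ, (∀ z : rectangle c ℓ₁ ℓ₂, catOp s x z = M z) ∧
      ∀ i : boundary (rectangle c ℓ₁ ℓ₂), x i = ξ i := by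
  classical
  let x : ℤ × ℤ → ℝ := fun z =>
    if hz : z ∈ rectangle c ℓ₁ ℓ₂ then
      ∑ w, green s (rectangle c ℓ₁ ℓ₂) ⟨z, hz⟩ w * M w +
        ∑ i, green s (rectangle c ℓ₁ ℓ₂) ⟨z, hz⟩ (inner i) * ξ i
    else if hz : z ∈ boundary (rectangle c ℓ₁ ℓ₂) then ξ ⟨z, hz⟩ else 0
  have hx : ∀ i : boundary (rectangle c ℓ₁ ℓ₂), x i = ξ i := fun i => by
    simp only [x]
    rw [dif_neg (Finset.mem_sdiff.1 i.2).2, dif_pos i.2]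
  refine ⟨x, (catOp_eq_iff_green hs M x).2 fun z => ?_, hx⟩
  simp only [hx]
  exact dif_pos z.2

theorem eq_of_eq_on_boundary {s : ℝ} (hs : 2 < s) {c : ℤ × ℤ} {ℓ₁ ℓ₂ : ℕ} {x y : ℤ × ℤ → ℝ}
    (hxy : ∀ z : rectangle c ℓ₁ ℓ₂, catOp s x z = catOp s y z)
    (h : ∀ i : boundary (rectangle c ℓ₁ ℓ₂), x i = y i) :
    ∀ z ∈ rectangle c ℓ₁ ℓ₂ ∪ boundary (rectangle c ℓ₁ ℓ₂), x z = y z := by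
  intro z hz
  rcases Finset.mem_union.1 hz with hz | hz
  · have hx := (catOp_eq_iff_green hs _ x).1 hxy ⟨z, hz⟩
    have hy := (catOp_eq_iff_green hs _ y).1 (fun _ => rfl) ⟨z, hz⟩
    simp only [h] at hx
    exact hx.trans hy.symm
  · exact h ⟨z, hz⟩

/-! ### The polytope and the free coordinates -/

/-- `x` takes values in `[0, 1)` on the closed rectangle and has the symbols `M` on `R`. -/
def IsBlock (s : ℝ) (R : Finset (ℤ × ℤ)) (M : R → ℤ) (x : ℤ × ℤ → ℝ) : Prop :=
  (∀ z ∈ R ∪ boundary R, 0 ≤ x z ∧ x z < 1) ∧ ∀ z : R, catOp s x z = M z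

/-- This removes the Green's function from view: points of the polytope are boundary traces of
blocks, just as `freeValues` consists of their traces on the free sites. -/
theorem mem_polytope_iff {s : ℝ} (hs : 2 < s) {c : ℤ × ℤ} {ℓ₁ ℓ₂ : ℕ}
    (M : rectangle c ℓ₁ ℓ₂ → ℤ) (ξ : boundary (rectangle c ℓ₁ ℓ₂) → ℝ) :
    ξ ∈ polytope s (rectangle c ℓ₁ ℓ₂) M ↔
      ∃ x, IsBlock s (rectangle c ℓ₁ ℓ₂) M x ∧ ∀ i : boundary (rectangle c ℓ₁ ℓ₂), x i = ξ i := by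
  constructor
  · rintro ⟨h1, h2⟩
    obtain ⟨x, hx, hξ⟩ := exists_dirichlet hs (fun z => (M z : ℝ)) ξ
    refine ⟨x, ⟨fun z hz => ?_, hx⟩, hξ⟩
    rcases Finset.mem_union.1 hz with hz | hz
    · have := (catOp_eq_iff_green hs _ x).1 hx ⟨z, hz⟩
      simp only [hξ] at this
      rw [this]
      exact h2 ⟨z, hz⟩
    · rw [hξ ⟨z, hz⟩]
      exact h1 ⟨z, hz⟩
  · rintro ⟨x, ⟨hx, hM⟩, hξ⟩
    refine ⟨fun i => hξ i ▸ hx i (Finset.mem_union_right _ i.2), fun z => ?_⟩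
    have := (catOp_eq_iff_green hs _ x).1 hM z
    simp only [hξ] at this
    rw [average, ← this]
    exact hx z (Finset.mem_union_left _ z.2)

theorem measurableSet_polytope (s : ℝ) (R : Finset (ℤ × ℤ)) (M : R → ℤ) :
    MeasurableSet (polytope s R M) := by
  simp only [polytope, Set.ofPred_and, Set.ofPred_forall]
  refine .inter (.iInter fun i => ?_) (.iInter fun z => ?_)
  all_goals
    refine .inter (measurableSet_le ?_ ?_) (measurableSet_lt ?_ ?_) <;> fun_prop

/-- The values at the free sites of all blocks with symbols `M`. -/
def freeValues (s : ℝ) (ℓ₁ ℓ₂ : ℕ) (M : rectangle 0 ℓ₁ ℓ₂ → ℤ) : Set (freeSites ℓ₁ ℓ₂ → ℝ) :=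
  {y | ∃ x, IsBlock s (rectangle 0 ℓ₁ ℓ₂) M x ∧ ∀ f : freeSites ℓ₁ ℓ₂, x f = y f}

theorem exists_catOp_freeSites (s : ℝ) (m : ℤ × ℤ → ℝ) {ℓ₁ ℓ₂ : ℕ} (h : 1 ≤ ℓ₁)
    (y : freeSites ℓ₁ ℓ₂ → ℝ) :
    ∃ x : ℤ × ℤ → ℝ, (∀ z, catOp s x z = m z) ∧ ∀ f : freeSites ℓ₁ ℓ₂, x f = y f := by
  obtain ⟨x, hx, hf⟩ := exists_solution_freeSites (fun z u => 2 * s * u - m z) h y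
  exact ⟨x, fun z => catOp_eq_iff.2 (hx z), hf⟩

theorem eq_of_catOp_eq {s : ℝ} {ℓ₁ ℓ₂ : ℕ} (h₁ : 1 ≤ ℓ₁) (h₂ : 1 ≤ ℓ₂) {x y : ℤ × ℤ → ℝ}
    (hxy : ∀ z ∈ rectangle 0 ℓ₁ ℓ₂, catOp s x z = catOp s y z)
    (h : ∀ z ∈ freeSites ℓ₁ ℓ₂, x z = y z) :
    ∀ z ∈ rectangle 0 ℓ₁ ℓ₂ ∪ boundary (rectangle 0 ℓ₁ ℓ₂), x z = y z :=
  eq_of_eq_on_freeSites (K := fun z u => 2 * s * u - catOp s y z) h₁ h₂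
    (fun z hz => catOp_eq_iff.1 (hxy z hz)) (fun _ _ => catOp_eq_iff.1 rfl) h

/-- The linear isomorphism between the free coordinates and the boundary coordinates of the
homogeneous solutions. -/
theorem exists_linearEquiv {s : ℝ} (hs : 2 < s) {ℓ₁ ℓ₂ : ℕ} (h₁ : 1 ≤ ℓ₁) (h₂ : 1 ≤ ℓ₂) :
    ∃ L : (freeSites ℓ₁ ℓ₂ → ℝ) ≃ₗ[ℝ] (boundary (rectangle 0 ℓ₁ ℓ₂) → ℝ),
      ∀ x : ℤ × ℤ → ℝ, (∀ z ∈ rectangle 0 ℓ₁ ℓ₂, catOp s x z = 0) →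
        L (fun f => x f) = fun i : boundary (rectangle 0 ℓ₁ ℓ₂) => x i := by
  -- `V` is the space of pairs of traces of homogeneous solutions. The first projection is bijective
  -- by the row and column recursions, the second by unique solvability of the Dirichlet problem;
  -- `L` is the second after the inverse of the first.
  let V : Submodule ℝ ((freeSites ℓ₁ ℓ₂ → ℝ) × (boundary (rectangle 0 ℓ₁ ℓ₂) → ℝ)) :=
    { carrier := {p | ∃ x : ℤ × ℤ → ℝ, (∀ z ∈ rectangle 0 ℓ₁ ℓ₂, catOp s x z = 0) ∧
        p = (fun f : freeSites ℓ₁ ℓ₂ => x f, fun i : boundary (rectangle 0 ℓ₁ ℓ₂) => x i)}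
      add_mem' := by
        rintro _ _ ⟨x, hx, rfl⟩ ⟨y, hy, rfl⟩
        exact ⟨x + y, fun z hz => by rw [catOp_add, hx z hz, hy z hz, add_zero], rfl⟩
      zero_mem' := ⟨0, fun z _ => by simp [catOp, laplacian], rfl⟩
      smul_mem' := by
        rintro r _ ⟨x, hx, rfl⟩
        exact ⟨r • x, fun z hz => by rw [catOp_smul, hx z hz, mul_zero], rfl⟩ }
  have e0 : ∀ z, catOp s 0 z = 0 := fun z => by simp [catOp, laplacian]
  let p := (LinearMap.fst ℝ _ _).comp V.subtype
  let q := (LinearMap.snd ℝ _ _).comp V.subtype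
  have hp : Function.Bijective p := by
    constructor
    · rw [injective_iff_map_eq_zero]
      rintro ⟨_, x, hx, rfl⟩ h
      have h0 := eq_of_catOp_eq (s := s) h₁ h₂ (x := x) (y := 0)
        (fun z hz => (hx z hz).trans (e0 z).symm) (fun z hz => congrFun h ⟨z, hz⟩)
      refine Subtype.ext (Prod.ext h (funext fun i => h0 i (Finset.mem_union_right _ i.2)))
    · intro y
      obtain ⟨x, hx, hf⟩ := exists_catOp_freeSites s 0 h₁ y
      exact ⟨⟨_, x, fun z _ => hx z, rfl⟩, funext hf⟩
  have hq : Function.Bijective q := by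
    constructor
    · rw [injective_iff_map_eq_zero]
      rintro ⟨_, x, hx, rfl⟩ h
      have h0 := eq_of_eq_on_boundary hs (x := x) (y := 0)
        (fun z => (hx z z.2).trans (e0 z).symm) (fun i => congrFun h i)
      refine Subtype.ext (Prod.ext (funext fun f => h0 f (freeSites_subset h₁ h₂ f.2)) h)
    · intro ξ
      obtain ⟨x, hx, hf⟩ := exists_dirichlet hs (fun _ => 0) ξ
      exact ⟨⟨_, x, fun z hz => hx ⟨z, hz⟩, rfl⟩, funext hf⟩
  refine ⟨(LinearEquiv.ofBijective p hp).symm.trans (LinearEquiv.ofBijective q hq), fun x hx => ?_⟩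
  have h : (LinearEquiv.ofBijective p hp).symm (fun f => x f) = ⟨_, x, hx, rfl⟩ := by
    rw [LinearEquiv.symm_apply_eq]
    rfl
  rw [LinearEquiv.trans_apply, h]
  rfl

theorem freeValues_eq_preimage {s : ℝ} (hs : 2 < s) {ℓ₁ ℓ₂ : ℕ} (h₁ : 1 ≤ ℓ₁)
    {L : (freeSites ℓ₁ ℓ₂ → ℝ) ≃ₗ[ℝ] (boundary (rectangle 0 ℓ₁ ℓ₂) → ℝ)}
    (hL : ∀ x : ℤ × ℤ → ℝ, (∀ z ∈ rectangle 0 ℓ₁ ℓ₂, catOp s x z = 0) →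
        L (fun f => x f) = fun i : boundary (rectangle 0 ℓ₁ ℓ₂) => x i) (M : rectangle 0 ℓ₁ ℓ₂ → ℤ) :
    ∃ ξ₀, freeValues s ℓ₁ ℓ₂ M = (fun y => L y + ξ₀) ⁻¹' polytope s (rectangle 0 ℓ₁ ℓ₂) M := by
  classical
  let m : ℤ × ℤ → ℝ := fun z => if hz : z ∈ rectangle 0 ℓ₁ ℓ₂ then M ⟨z, hz⟩ else 0
  have hm : ∀ z : rectangle 0 ℓ₁ ℓ₂, m z = M z := fun z => dif_pos z.2
  -- A particular solution with zero free values: subtracting it makes a block homogeneous without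
  -- changing its free values. Only its boundary trace `ξ₀` depends on `M`.
  obtain ⟨x₀, hx₀, hf₀⟩ := exists_catOp_freeSites s m (ℓ₂ := ℓ₂) h₁ 0
  refine ⟨fun i => x₀ i, Set.ext fun y => ?_⟩
  rw [Set.mem_preimage, mem_polytope_iff hs]
  constructor
  · rintro ⟨x, hx, hy⟩
    refine ⟨x, hx, fun i => ?_⟩
    have := hL (x - x₀) fun z hz => by
      rw [catOp_sub, hx.2 ⟨z, hz⟩, hx₀, hm ⟨z, hz⟩, sub_self]
    have e : (fun f : freeSites ℓ₁ ℓ₂ => (x - x₀) f) = y := by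
      funext f
      simp [hf₀, hy]
    rw [e] at this
    simp [this]
  · rintro ⟨x, hx, hξ⟩
    obtain ⟨w, hw, hwy⟩ := exists_catOp_freeSites s 0 h₁ y
    have hLw := hL w fun z _ => hw z
    have e : (fun f : freeSites ℓ₁ ℓ₂ => w f) = y := funext hwy
    rw [e] at hLw
    have hM : ∀ z : rectangle 0 ℓ₁ ℓ₂, catOp s (w + x₀) z = M z := fun z => by
      rw [catOp_add, hw, hx₀, hm, Pi.zero_apply, zero_add]
    have key := eq_of_eq_on_boundary hs (x := w + x₀) (y := x)
      (fun z => (hM z).trans (hx.2 z).symm) (fun i => by rw [hξ, hLw]; rfl)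
    exact ⟨w + x₀, ⟨fun z hz => by rw [key z hz]; exact hx.1 z hz, hM⟩,
      fun f => by simp [hwy, hf₀]⟩

/-- The volumes of the set of free values and of the polytope are proportional. -/
theorem exists_volume_freeValues {s : ℝ} (hs : 2 < s) {ℓ₁ ℓ₂ : ℕ} (h₁ : 1 ≤ ℓ₁) (h₂ : 1 ≤ ℓ₂) :
    ∃ d : NNReal, ∀ M : rectangle 0 ℓ₁ ℓ₂ → ℤ, MeasurableSet (freeValues s ℓ₁ ℓ₂ M) ∧
      volume (freeValues s ℓ₁ ℓ₂ M) = d * volume (polytope s (rectangle 0 ℓ₁ ℓ₂) M) := by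
  obtain ⟨L, hL⟩ := exists_linearEquiv hs h₁ h₂
  have hLm : Measurable L := (LinearMap.continuous_on_pi L.toLinearMap).measurable
  have : (Measure.map L volume).IsAddHaarMeasure :=
    L.toContinuousLinearEquiv.isAddHaarMeasure_map volume
  -- Uniqueness of Haar measure supplies the Jacobian factor; it is fixed by `L` before any block is
  -- chosen.
  obtain ⟨d, hd⟩ : ∃ d : NNReal, Measure.map L volume = d • volume :=
    ⟨_, Measure.isAddLeftInvariant_eq_smul (Measure.map L volume) volume⟩
  refine ⟨d, fun M => ?_⟩
  obtain ⟨ξ₀, h⟩ := freeValues_eq_preimage hs h₁ hL M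
  have hP := measurableSet_polytope s (rectangle 0 ℓ₁ ℓ₂) M
  have hP' : MeasurableSet ((fun ξ => ξ + ξ₀) ⁻¹' polytope s (rectangle 0 ℓ₁ ℓ₂) M) :=
    measurable_add_const ξ₀ hP
  have h' : freeValues s ℓ₁ ℓ₂ M =
      L ⁻¹' ((fun ξ => ξ + ξ₀) ⁻¹' polytope s (rectangle 0 ℓ₁ ℓ₂) M) := h
  refine ⟨h' ▸ hLm hP', ?_⟩
  rw [h', ← Measure.map_apply hLm hP', hd, Measure.smul_apply, measure_preimage_add_right]
  rfl

/-! ### Translation to the origin -/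

theorem catOp_translate (s : ℝ) (x : ℤ × ℤ → ℝ) (c z : ℤ × ℤ) :
    catOp s (fun w => x (w + c)) z = catOp s x (z + c) := by
  obtain ⟨p, q⟩ := c
  obtain ⟨n, t⟩ := z
  simp only [catOp, laplacian, Prod.mk_add_mk, add_right_comm _ (1 : ℤ), sub_add_eq_add_sub]

theorem add_mem_rectangle {c z : ℤ × ℤ} {ℓ₁ ℓ₂ : ℕ} :
    z + c ∈ rectangle c ℓ₁ ℓ₂ ↔ z ∈ rectangle 0 ℓ₁ ℓ₂ := by
  obtain ⟨n, t⟩ := z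
  have : (n, t) + c = (n + c.1, t + c.2) := rfl
  rw [this, mem_rectangle, mem_rectangle]
  simp only [Prod.fst_zero, Prod.snd_zero]
  omega

theorem add_mem_boundary {c z : ℤ × ℤ} {ℓ₁ ℓ₂ : ℕ} (h₁ : 1 ≤ ℓ₁) (h₂ : 1 ≤ ℓ₂) :
    z + c ∈ boundary (rectangle c ℓ₁ ℓ₂) ↔ z ∈ boundary (rectangle 0 ℓ₁ ℓ₂) := by
  obtain ⟨n, t⟩ := z
  have : (n, t) + c = (n + c.1, t + c.2) := rfl
  rw [this, mem_boundary_rectangle h₁ h₂, mem_boundary_rectangle h₁ h₂]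
  simp only [Prod.fst_zero, Prod.snd_zero]
  omega

/-- The block of symbols `M`, moved to the origin. -/
def translateBlock {c : ℤ × ℤ} {ℓ₁ ℓ₂ : ℕ} (M : rectangle c ℓ₁ ℓ₂ → ℤ) :
    rectangle 0 ℓ₁ ℓ₂ → ℤ :=
  fun z => M ⟨z + c, add_mem_rectangle.2 z.2⟩

theorem isBlock_translate {s : ℝ} {c : ℤ × ℤ} {ℓ₁ ℓ₂ : ℕ} (h₁ : 1 ≤ ℓ₁) (h₂ : 1 ≤ ℓ₂)
    {M : rectangle c ℓ₁ ℓ₂ → ℤ} {x : ℤ × ℤ → ℝ} :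
    IsBlock s (rectangle 0 ℓ₁ ℓ₂) (translateBlock M) (fun z => x (z + c)) ↔
      IsBlock s (rectangle c ℓ₁ ℓ₂) M x := by
  refine and_congr ?_ ?_
  · rw [← (Equiv.addRight c).forall_congr_right (q := fun z =>
      z ∈ rectangle c ℓ₁ ℓ₂ ∪ boundary (rectangle c ℓ₁ ℓ₂) → 0 ≤ x z ∧ x z < 1)]
    simp only [Equiv.coe_addRight, Finset.mem_union, add_mem_rectangle, add_mem_boundary h₁ h₂]
  · simp only [catOp_translate]
    refine ⟨fun h z => ?_, fun h z => h ⟨z + c, add_mem_rectangle.2 z.2⟩⟩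
    have hz : (z : ℤ × ℤ) - c ∈ rectangle 0 ℓ₁ ℓ₂ := by
      rw [← add_mem_rectangle (c := c), sub_add_cancel]
      exact z.2
    simpa [translateBlock] using h ⟨z - c, hz⟩

/-- Describing both polytopes by blocks reduces the claim to a reindexing of coordinates and avoids
comparing the Green's functions of the two rectangles. -/
theorem volume_polytope_translate {s : ℝ} (hs : 2 < s) {c : ℤ × ℤ} {ℓ₁ ℓ₂ : ℕ} (h₁ : 1 ≤ ℓ₁)
    (h₂ : 1 ≤ ℓ₂) (M : rectangle c ℓ₁ ℓ₂ → ℤ) :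
    volume (polytope s (rectangle 0 ℓ₁ ℓ₂) (translateBlock M)) =
      volume (polytope s (rectangle c ℓ₁ ℓ₂) M) := by
  let e : boundary (rectangle 0 ℓ₁ ℓ₂) ≃ boundary (rectangle c ℓ₁ ℓ₂) :=
    (Equiv.addRight c).subtypeEquiv fun z => (add_mem_boundary h₁ h₂).symm
  have he : ∀ i, (e i : ℤ × ℤ) = i + c := fun i => rfl
  have hp := volume_measurePreserving_piCongrLeft (fun _ => ℝ) e
  rw [← hp.measure_preimage_equiv]
  congr 1
  ext ξ
  have hξ : ∀ i, MeasurableEquiv.piCongrLeft (fun _ => ℝ) e ξ (e i) = ξ i := fun i =>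
    Equiv.piCongrLeft_apply_apply (fun _ => ℝ) e ξ i
  rw [Set.mem_preimage, mem_polytope_iff hs, mem_polytope_iff hs]
  constructor
  · rintro ⟨x, hx, h⟩
    refine ⟨fun z => x (z - c), (isBlock_translate h₁ h₂).1 (by simpa using hx), fun i => ?_⟩
    obtain ⟨j, rfl⟩ := e.surjective i
    simp only [hξ, he, add_sub_cancel_right, h]
  · rintro ⟨x, hx, h⟩
    exact ⟨fun z => x (z + c), (isBlock_translate h₁ h₂).2 hx, fun i => by simp only [← he, h, hξ]⟩

/-! ### The measure of the cylinder sets -/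

theorem neighbors_subset {R : Finset (ℤ × ℤ)} {z : ℤ × ℤ} (hz : z ∈ R) :
    neighbors z ⊆ R ∪ boundary R := fun w hw => by
  by_cases h : w ∈ R
  · exact Finset.mem_union_left _ h
  · exact Finset.mem_union_right _ (Finset.mem_sdiff.2 ⟨Finset.mem_biUnion.2 ⟨z, hz, hw⟩, h⟩)

theorem solvesAt_coe {s : ℝ} {k : ℤ} (hk : (k : ℝ) = 2 * s) {x : ℤ × ℤ → ℝ} {z : ℤ × ℤ} {m : ℤ}
    (h : catOp s x z = m) :
    SolvesAt (fun _ u => k • u) (fun w => (x w : UnitAddCircle)) z := by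
  have hm : ((m : ℝ) : UnitAddCircle) = 0 := AddCircle.coe_eq_zero_iff 1 |>.2 ⟨m, by simp⟩
  have := congrArg (fun r : ℝ => (r : UnitAddCircle)) (catOp_eq_iff.1 h)
  simp only [AddCircle.coe_add, AddCircle.coe_sub, hm, sub_zero, ← hk, ← zsmul_eq_mul,
    AddCircle.coe_zsmul] at this
  exact this

/-- The substance is the converse. A real block `x` and the lattice state agree at the free sites
and solve the same equation modulo 1, so they agree modulo 1 on the closed rectangle. Both take
values in `[0,1)` there, so they are equal as real numbers and have the same symbols. -/
theorem cylinder_eq_preimage {s : ℝ} {a b : ℤ} (hab : (a : ℝ) + b = 2 * s) {c : ℤ × ℤ}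
    {ℓ₁ ℓ₂ : ℕ} (h₁ : 1 ≤ ℓ₁) (h₂ : 1 ≤ ℓ₂) (M : rectangle c ℓ₁ ℓ₂ → ℤ) :
    cylinder s a b (rectangle c ℓ₁ ℓ₂) M =
      (fun Z (f : freeSites ℓ₁ ℓ₂) => latticeState a b Z (f + c)) ⁻¹'
        freeValues s ℓ₁ ℓ₂ (translateBlock M) := by
  ext Z
  constructor
  · intro hZ
    exact ⟨fun z => latticeState a b Z (z + c),
      (isBlock_translate h₁ h₂).2 ⟨fun z _ => latticeState_mem a b Z z, hZ⟩, fun f => rfl⟩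
  · rintro ⟨x, hx, hf⟩
    have hτ : ∀ z, SolvesAt (fun _ u => (a + b) • u) (fun w => circleState a b Z (w + c)) z :=
      fun z => by
        have := solvesAt_circleState a b Z (z + c)
        obtain ⟨p, q⟩ := c
        obtain ⟨n, t⟩ := z
        simpa only [SolvesAt, Prod.mk_add_mk, add_right_comm _ (1 : ℤ), sub_add_eq_add_sub]
          using this
    have hcoe := eq_of_eq_on_freeSites h₁ h₂
      (fun z hz => solvesAt_coe (k := a + b) (by exact_mod_cast hab) (hx.2 ⟨z, hz⟩))
      (fun z _ => hτ z) (fun f hf' => by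
        rw [← coe_latticeState]
        exact congrArg _ (hf ⟨f, hf'⟩))
    have hxz : ∀ z ∈ rectangle 0 ℓ₁ ℓ₂ ∪ boundary (rectangle 0 ℓ₁ ℓ₂),
        latticeState a b Z (z + c) = x z := fun z hz => by
      have h := hcoe z hz
      rw [← coe_latticeState] at h
      refine ((AddCircle.coe_eq_coe_iff_of_mem_Ico (p := (1 : ℝ)) (a := 0) ?_ ?_).1 h).symm <;>
        rw [zero_add]
      · exact hx.1 z hz
      · exact latticeState_mem a b Z _
    have hblock : IsBlock s (rectangle 0 ℓ₁ ℓ₂) (translateBlock M)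
        (fun z => latticeState a b Z (z + c)) := by
      refine ⟨fun z _ => latticeState_mem a b Z _, fun z => ?_⟩
      rw [← hx.2 z, catOp_eq_sum_neighbors, catOp_eq_sum_neighbors,
        hxz z (Finset.mem_union_left _ z.2),
        Finset.sum_congr rfl fun w hw => hxz w (neighbors_subset z.2 hw)]
    exact ((isBlock_translate h₁ h₂).1 hblock).2

theorem freeValues_subset {s : ℝ} {ℓ₁ ℓ₂ : ℕ} (h₁ : 1 ≤ ℓ₁) (h₂ : 1 ≤ ℓ₂)
    (M : rectangle 0 ℓ₁ ℓ₂ → ℤ) :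
    freeValues s ℓ₁ ℓ₂ M ⊆ Set.univ.pi fun _ => Set.Ico 0 1 := by
  rintro y ⟨x, hx, hf⟩ f -
  rw [← hf]
  exact hx.1 f (freeSites_subset h₁ h₂ f.2)

theorem exists_measure_cylinder {s : ℝ} (hs : 2 < s) {ℓ₁ ℓ₂ : ℕ} (h₁ : 1 ≤ ℓ₁) (h₂ : 1 ≤ ℓ₂) :
    ∃ d : ℝ, ∀ a b : ℤ, (a : ℝ) + b = 2 * s → ∀ (c : ℤ × ℤ) (M : rectangle c ℓ₁ ℓ₂ → ℤ),
      naturalMeasure.real (cylinder s a b (rectangle c ℓ₁ ℓ₂) M) =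
        d * volume.real (polytope s (rectangle c ℓ₁ ℓ₂) M) := by
  obtain ⟨d, hd⟩ := exists_volume_freeValues hs h₁ h₂
  refine ⟨d, fun a b hab c M => ?_⟩
  obtain ⟨hm, hv⟩ := hd (translateBlock M)
  rw [measureReal_def, cylinder_eq_preimage hab h₁ h₂,
    (measurePreserving_latticeState ℓ₂ h₁ a b c).measure_preimage hm.nullMeasurableSet,
    Measure.restrict_apply hm, Set.inter_eq_left.2 (freeValues_subset h₁ h₂ _), hv,
    volume_polytope_translate hs h₁ h₂, ENNReal.toReal_mul]
  rfl

end CatLattice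

end

theorem theorem2 (s : ℝ) (hs : 2 < s) :
    ∃ d : ℕ → ℕ → ℝ, ∀ a b : ℤ, (a : ℝ) + b = 2 * s →
      ∀ (c : ℤ × ℤ) (ℓ₁ ℓ₂ : ℕ), 1 ≤ ℓ₁ → 1 ≤ ℓ₂ →
        ∀ M : CatLattice.rectangle c ℓ₁ ℓ₂ → ℤ, (∀ z, M z ∈ CatLattice.alphabet s) →
          CatLattice.naturalMeasure.real
              (CatLattice.cylinder s a b (CatLattice.rectangle c ℓ₁ ℓ₂) M) =
            d ℓ₁ ℓ₂ *
              volume.real (CatLattice.polytope s (CatLattice.rectangle c ℓ₁ ℓ₂) M) := by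
  have h : ∀ ℓ₁ ℓ₂ : ℕ, ∃ d : ℝ, 1 ≤ ℓ₁ → 1 ≤ ℓ₂ → ∀ a b : ℤ, (a : ℝ) + b = 2 * s →
      ∀ (c : ℤ × ℤ) (M : CatLattice.rectangle c ℓ₁ ℓ₂ → ℤ),
        CatLattice.naturalMeasure.real
            (CatLattice.cylinder s a b (CatLattice.rectangle c ℓ₁ ℓ₂) M) =
          d * volume.real (CatLattice.polytope s (CatLattice.rectangle c ℓ₁ ℓ₂) M) := by
    intro ℓ₁ ℓ₂
    by_cases hℓ : 1 ≤ ℓ₁ ∧ 1 ≤ ℓ₂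
    · obtain ⟨d, hd⟩ := CatLattice.exists_measure_cylinder hs hℓ.1 hℓ.2
      exact ⟨d, fun _ _ => hd⟩
    -- For an empty rectangle the factor is a dummy, needed so that `d` can be chosen as a function
    -- of all pairs of sizes.
    · exact ⟨0, fun h₁ h₂ => absurd ⟨h₁, h₂⟩ hℓ⟩
  choose d hd using h
  exact ⟨d, fun a b hab c ℓ₁ ℓ₂ h₁ h₂ M _ => hd ℓ₁ ℓ₂ h₁ h₂ a b hab c M⟩
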